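/- All Banach spaces are complex. For $N\ge 1$ let $\mathcal P({}^N E;F)$ be the space of continuous $N$-homogeneous polynomials $P:E\to F$ (that is, $P(x)=A(x,\dots,x)$ for some continuous $N$-linear map $A:E^N\to F$), normed by $\|P\|=\sup_{\|x\|\le 1}\|P(x)\|$, and let $\mathcal P({}^N E)=\mathcal P({}^N E;\mathbb C)$. Let $\mathcal P_w({}^N E;F)$ be the subspace of those $P$ whose restriction to every bounded subset of $E$ is continuous from the weak topology to the norm topology. A Banach space $E$ is $\mathcal P_N$-reflexive if $\mathcal P({}^N E)$ is a reflexive Banach space, and polynomially reflexive if this holds for every $N\ge 1$. $E$ has the compact approximation property (CAP) if for every compact $K\subset E$ and every $\varepsilon>0$ there is a compact linear operator $T:E\to E$ with $\|Tx-x\|\le\varepsilon$ for all $x\in K$. A Banach space $F$ is polynomially Schur (respectively, $\mathcal P_N$-Schur) if every sequence $(y_n)$ in $F$ such that $Q(y_n)\to 0$ for all $Q\in\mathcal P({}^k F)$ and all $k\ge 1$ (respectively, for all $Q\in\mathcal P({}^N F)$) satisfies $\|y_n\|\to 0$. Proposition (polynomial Schur). Let $E$ and $F$ be complex Banach spaces.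 (1) If $E$ is polynomially reflexive and has the CAP, and $F$ is polynomially Schur, then $\mathcal P({}^N E;F)=\mathcal P_w({}^N E;F)$ for every integer $N\ge 1$. (2) Let $N,M\ge 1$ be integers. If $E$ is $\mathcal P_{NM}$-reflexive and has the CAP, and $F$ is $\mathcal P_N$-Schur, then $\mathcal P({}^M E;F)=\mathcal P_w({}^M E;F)$. -/

import Mathlib

open Filter Topology

/-- The functions `E → F` of the form `x ↦ A (x, …, x)` for a continuous `N`-linear map `A`,
i.e. the continuous `N`-homogeneous polynomials. -/
def homPolySubmodule (N : ℕ) (E F : Type*) [NormedAddCommGroup E] [NormedSpace ℂ E]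
    [NormedAddCommGroup F] [NormedSpace ℂ F] : Submodule ℂ (E → F) where
  carrier := {P | ∃ A : ContinuousMultilinearMap ℂ (fun _ : Fin N => E) F,
    ∀ x, P x = A (fun _ => x)}
  add_mem' := by
    rintro P Q ⟨A, hA⟩ ⟨B, hB⟩
    exact ⟨A + B, fun x => by simp [hA x, hB x]⟩
  zero_mem' := ⟨0, fun x => by simp⟩
  smul_mem' := by
    rintro c P ⟨A, hA⟩
    exact ⟨c • A, fun x => by simp [hA x]⟩

/-- The space of continuous `N`-homogeneous polynomials from `E` to `F`. It is a type of its own,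
so that it carries the norm topology and not the topology of pointwise convergence. -/
def HomPoly (N : ℕ) (E F : Type*) [NormedAddCommGroup E] [NormedSpace ℂ E]
    [NormedAddCommGroup F] [NormedSpace ℂ F] : Type _ :=
  homPolySubmodule N E F

namespace HomPoly

variable {N : ℕ} {E F : Type*} [NormedAddCommGroup E] [NormedSpace ℂ E]
  [NormedAddCommGroup F] [NormedSpace ℂ F]

instance : AddCommGroup (HomPoly N E F) := inferInstanceAs (AddCommGroup (homPolySubmodule N E F))

instance : Module ℂ (HomPoly N E F) := inferInstanceAs (Module ℂ (homPolySubmodule N E F))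

instance : FunLike (HomPoly N E F) E F where
  coe P := P.1
  coe_injective _ _ h := Subtype.ext h

theorem exists_multilinear (P : HomPoly N E F) :
    ∃ A : ContinuousMultilinearMap ℂ (fun _ : Fin N => E) F, ∀ x, P x = A (fun _ => x) := P.2

theorem add_apply (P Q : HomPoly N E F) (x : E) : (P + Q) x = P x + Q x := rfl

theorem smul_apply (c : ℂ) (P : HomPoly N E F) (x : E) : (c • P) x = c • P x := rfl

theorem zero_apply (x : E) : (0 : HomPoly N E F) x = 0 := rfl

/-- The sup norm over the closed unit ball. -/
noncomputable instance : Norm (HomPoly N E F) where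
  norm P := ⨆ x : Metric.closedBall (0 : E) 1, ‖P x‖

theorem norm_def (P : HomPoly N E F) : ‖P‖ = ⨆ x : Metric.closedBall (0 : E) 1, ‖P x‖ := rfl

theorem bddAbove (P : HomPoly N E F) :
    BddAbove (Set.range fun x : Metric.closedBall (0 : E) 1 => ‖P x‖) := by
  obtain ⟨A, hA⟩ := P.exists_multilinear
  refine ⟨‖A‖, ?_⟩
  rintro _ ⟨x, rfl⟩
  have hx : ‖(x : E)‖ ≤ 1 := mem_closedBall_zero_iff.1 x.2
  simp only [hA]
  calc ‖A fun _ => (x : E)‖ ≤ ‖A‖ * ∏ _i : Fin N, ‖(x : E)‖ := A.le_opNorm _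
    _ ≤ ‖A‖ * 1 := by
      gcongr
      simpa using pow_le_one₀ (norm_nonneg _) hx
    _ = ‖A‖ := mul_one _

theorem norm_apply_le (P : HomPoly N E F) {x : E} (hx : ‖x‖ ≤ 1) : ‖P x‖ ≤ ‖P‖ :=
  le_ciSup P.bddAbove (⟨x, by simpa using hx⟩ : Metric.closedBall (0 : E) 1)

theorem map_smul_pow (P : HomPoly N E F) (c : ℂ) (x : E) : P (c • x) = c ^ N • P x := by
  obtain ⟨A, hA⟩ := P.exists_multilinear
  rw [hA, hA]
  simpa using A.map_smul_univ (fun _ => c) (fun _ => x)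

theorem normCore : NormedSpace.Core ℂ (HomPoly N E F) where
  norm_nonneg P := Real.iSup_nonneg fun _ => norm_nonneg _
  norm_smul c P := by
    simp only [norm_def, smul_apply, norm_smul]
    exact (Real.mul_iSup_of_nonneg (norm_nonneg c) _).symm
  norm_triangle P Q := by
    have : Nonempty (Metric.closedBall (0 : E) 1) := ⟨⟨0, by simp⟩⟩
    refine ciSup_le fun x => ?_
    have hx : ‖(x : E)‖ ≤ 1 := mem_closedBall_zero_iff.1 x.2
    rw [add_apply]
    exact (norm_add_le _ _).trans (add_le_add (P.norm_apply_le hx) (Q.norm_apply_le hx))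
  norm_eq_zero_iff P := by
    constructor
    · intro h
      have key : ∀ x : E, ‖x‖ ≤ 1 → P x = 0 := fun x hx =>
        norm_le_zero_iff.1 (h ▸ P.norm_apply_le hx)
      refine DFunLike.ext _ _ fun x => ?_
      rw [zero_apply]
      by_cases hx : x = 0
      · exact key x (by simp [hx])
      · have hx' : ‖x‖ ≠ 0 := norm_ne_zero_iff.2 hx
        have h1 : x = (‖x‖ : ℂ) • ((‖x‖ : ℂ)⁻¹ • x) := by
          rw [smul_smul, mul_inv_cancel₀ (by exact_mod_cast hx'), one_smul]
        rw [h1, map_smul_pow, key _ (by simp [norm_smul, hx']), smul_zero]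
    · rintro rfl
      simp [norm_def, zero_apply]

noncomputable instance : NormedAddCommGroup (HomPoly N E F) := NormedAddCommGroup.ofCore normCore

noncomputable instance : NormedSpace ℂ (HomPoly N E F) := NormedSpace.ofCore normCore

/-- The subspace of those polynomials that are weak-to-norm continuous on every bounded subset
of `E`. -/
def weaklyContinuousOnBounded (N : ℕ) (E F : Type*) [NormedAddCommGroup E] [NormedSpace ℂ E]
    [NormedAddCommGroup F] [NormedSpace ℂ F] : Submodule ℂ (HomPoly N E F) where
  carrier := {P | ∀ S : Set E, Bornology.IsBounded S →
    ContinuousOn (fun x : WeakSpace ℂ E => P ((toWeakSpace ℂ E).symm x)) (toWeakSpace ℂ E '' S)}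
  add_mem' hP hQ S hS := (hP S hS).add (hQ S hS)
  zero_mem' _ _ := continuousOn_const (c := (0 : F))
  smul_mem' c _ hP S hS := (hP S hS).const_smul c

end HomPoly

/-- Reflexivity: the canonical map into the bidual is onto. -/
def IsReflexiveSpace (X : Type*) [NormedAddCommGroup X] [NormedSpace ℂ X] : Prop :=
  Function.Surjective (NormedSpace.inclusionInDoubleDual ℂ X)

/-- The compact approximation property: the identity is a limit of compact operators, uniformly
on compact sets. -/
def HasCAP (E : Type*) [NormedAddCommGroup E] [NormedSpace ℂ E] : Prop :=
  ∀ K : Set E, IsCompact K → ∀ ε : ℝ, 0 < ε →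
    ∃ T : E →L[ℂ] E, IsCompactOperator T ∧ ∀ x ∈ K, ‖T x - x‖ ≤ ε

/-- `𝒫_N`-reflexivity: the space of scalar `N`-homogeneous polynomials is reflexive. -/
def IsPolyReflexiveOfDegree (N : ℕ) (E : Type*) [NormedAddCommGroup E] [NormedSpace ℂ E] : Prop :=
  IsReflexiveSpace (HomPoly N E ℂ)

def IsPolynomiallyReflexive (E : Type*) [NormedAddCommGroup E] [NormedSpace ℂ E] : Prop :=
  ∀ N : ℕ, 1 ≤ N → IsPolyReflexiveOfDegree N E

/-- The `𝒫_N`-Schur property. -/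
def IsPolySchurOfDegree (N : ℕ) (F : Type*) [NormedAddCommGroup F] [NormedSpace ℂ F] : Prop :=
  ∀ u : ℕ → F, (∀ Q : HomPoly N F ℂ, Tendsto (fun n => Q (u n)) atTop (𝓝 0)) →
    Tendsto u atTop (𝓝 0)

/-- The polynomial Schur property. Only degrees `≥ 1` are tested: the non-zero constants, of
degree `0`, do not tend to `0` along any sequence. -/
def IsPolynomiallySchur (F : Type*) [NormedAddCommGroup F] [NormedSpace ℂ F] : Prop :=
  ∀ u : ℕ → F,
    (∀ N : ℕ, 1 ≤ N → ∀ Q : HomPoly N F ℂ, Tendsto (fun n => Q (u n)) atTop (𝓝 0)) →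
    Tendsto u atTop (𝓝 0)

/-! Reflexivity of the space of scalar `N`-homogeneous polynomials makes every functional on it
continuous for uniform convergence on compact sets. By Hahn–Banach, any functional is then a norm
limit of functionals controlled by finitely many points, and iterating this with rescaled points
gives a compact controlling set (`exists_isCompact_dominating`). If `T` is compact and close to the
identity on that set, a functional cannot distinguish `P` from `P ∘ T` beyond a small error. Since
`P ∘ T` is weakly sequentially continuous, so is its norm limit `P` (`tendsto_of_weak`). For
vector-valued `P`, apply this to `Q ∘ H` with `Q` a scalar polynomial on `F`. The Schur property
detects only null sequences, and `P - P x` is not homogeneous, so `P` is corrected to a homogeneous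
`H` with `H x = 0` (`exists_sub_tendsto`). Finally `E` is itself reflexive, because its dual is
complemented in the polynomial space. Weak closure points of bounded sets are therefore sequential
limits, and sequential continuity suffices. -/

/-! ### Separation, reflexivity and weak sequential limits -/

section BanachSpaces

variable {X : Type*} [NormedAddCommGroup X] [NormedSpace ℂ X]

/-- A point outside the closure of a subspace is separated from it by a functional. -/
theorem Submodule.exists_strongDual_of_notMem_closure (V : Submodule ℂ X) {x : X}
    (hx : x ∉ closure (V : Set X)) :
    ∃ f : StrongDual ℂ X, (∀ v ∈ V, f v = 0) ∧ f x ≠ 0 := by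
  have hconv : Convex ℝ (closure (V : Set X)) := by
    have : Convex ℝ ((V.restrictScalars ℝ : Submodule ℝ X) : Set X) :=
      (V.restrictScalars ℝ).convex
    exact Convex.closure this
  obtain ⟨f, u, hf, hu⟩ :=
    RCLike.geometric_hahn_banach_closed_point (𝕜 := ℂ) hconv isClosed_closure hx
  have h0 : 0 < u := by simpa using hf 0 (subset_closure V.zero_mem)
  refine ⟨f, fun v hv => ?_, fun h => ?_⟩
  · by_contra hne
    -- This multiple of `v` takes the value `u` under `f`, against the strict bound `< u` on the
    -- subspace.
    have := hf (((u : ℂ) * (f v)⁻¹) • v) (subset_closure (V.smul_mem _ hv))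
    rw [map_smul, smul_eq_mul, mul_assoc, inv_mul_cancel₀ hne] at this
    simp at this
  · rw [h] at hu
    simp at hu
    linarith

/-- Reflexivity passes to complemented subspaces. -/
theorem IsReflexiveSpace.of_leftInverse {Y : Type*} [NormedAddCommGroup Y] [NormedSpace ℂ Y]
    (hY : IsReflexiveSpace Y) (j : X →L[ℂ] Y) (r : Y →L[ℂ] X) (hrj : ∀ x, r (j x) = x) :
    IsReflexiveSpace X := by
  intro ξ
  obtain ⟨y, hy⟩ := hY (ξ.comp ((ContinuousLinearMap.compL ℂ X Y ℂ).flip j))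
  refine ⟨r y, ContinuousLinearMap.ext fun φ => ?_⟩
  have := DFunLike.congr_fun hy (φ.comp r)
  simp only [NormedSpace.dual_def, ContinuousLinearMap.comp_apply, ContinuousLinearMap.flip_apply,
    ContinuousLinearMap.compL_apply] at this
  rw [NormedSpace.dual_def, this]
  congr 1
  ext x
  simp [hrj]

/-- A Banach space with a reflexive dual is reflexive. -/
theorem IsReflexiveSpace.of_strongDual [CompleteSpace X]
    (h : IsReflexiveSpace (StrongDual ℂ X)) : IsReflexiveSpace X := by
  intro ξ
  by_contra hξ
  set V : Submodule ℂ (StrongDual ℂ (StrongDual ℂ X)) :=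
    LinearMap.range (NormedSpace.inclusionInDoubleDual ℂ X).toLinearMap with hV
  have hclosed : IsClosed (V : Set (StrongDual ℂ (StrongDual ℂ X))) := by
    exact (NormedSpace.inclusionInDoubleDualLi (E := X)
      ℂ).isometry.isUniformInducing.isComplete_range.isClosed
  obtain ⟨Ψ, hΨ, hne⟩ := V.exists_strongDual_of_notMem_closure (x := ξ) (by
    rw [hclosed.closure_eq]
    rintro ⟨x, hx⟩
    exact hξ ⟨x, hx⟩)
  obtain ⟨φ, rfl⟩ := h Ψ
  apply hne
  have : φ = 0 := by
    ext x
    exact hΨ (NormedSpace.inclusionInDoubleDual ℂ X x) ⟨x, rfl⟩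
  simp [this]

theorem IsReflexiveSpace.isCompact_closure (h : IsReflexiveSpace X) {A : Set X}
    (hA : Bornology.IsBounded A) : IsCompact (closure (toWeakSpace ℂ X '' A)) := by
  refine NormedSpace.isCompact_closure_of_isBounded ℂ X _ ?_ fun ξ _ => ?_
  · rwa [Set.preimage_image_eq _ (toWeakSpace ℂ X).injective]
  · obtain ⟨x, hx⟩ := h (WeakDual.toStrongDual ξ)
    refine ⟨toWeakSpace ℂ X x, ?_⟩
    apply DFunLike.ext
    intro φ
    exact DFunLike.congr_fun hx φ

theorem continuous_weakSpace_eval (φ : StrongDual ℂ X) :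
    Continuous fun x : WeakSpace ℂ X => φ ((toWeakSpace ℂ X).symm x) :=
  WeakBilin.eval_continuous (topDualPairing ℂ X).flip φ

/-- A finite set of functionals in the unit ball norms the span of a finite set up to a
factor `2`. -/
theorem exists_finset_norming (s : Finset X) :
    ∃ Φ : Finset (StrongDual ℂ X), (∀ φ ∈ Φ, ‖φ‖ ≤ 1) ∧
      ∀ g ∈ Submodule.span ℂ (s : Set X), g ≠ 0 → ∃ φ ∈ Φ, ‖g‖ ≤ 2 * ‖φ g‖ := by
  classical
  set V := Submodule.span ℂ (s : Set X)
  have : FiniteDimensional ℂ V := FiniteDimensional.span_finset ℂ s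
  have : ProperSpace V := FiniteDimensional.proper ℂ V
  have hc : IsCompact (Metric.sphere (0 : V) 1) := isCompact_sphere 0 1
  choose φ hφ1 hφ2 using fun x : V => exists_dual_vector'' ℂ (x : X)
  -- Functionals norming a finite `1/2`-net of the unit sphere lose at most `1/2` at any other unit
  -- vector.
  obtain ⟨t, ht, hcov⟩ := hc.elim_nhds_subcover (fun x => Metric.ball x (1 / 2))
    fun x _ => Metric.ball_mem_nhds x (by norm_num)
  refine ⟨t.image φ, ?_, fun g hg hg0 => ?_⟩
  · intro ψ hψ
    obtain ⟨x, -, rfl⟩ := Finset.mem_image.1 hψ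
    exact hφ1 x
  · have hn : ‖g‖ ≠ 0 := norm_ne_zero_iff.2 hg0
    set g' : V := (‖g‖⁻¹ : ℂ) • ⟨g, hg⟩ with hg'
    have hmem : g' ∈ Metric.sphere (0 : V) 1 := by
      simp [hg', norm_smul, hn]
    obtain ⟨x, hx, hgx⟩ := Set.mem_iUnion₂.1 (hcov hmem)
    refine ⟨φ x, Finset.mem_image_of_mem _ hx, ?_⟩
    have hx1 : ‖(x : X)‖ = 1 := by simpa using ht x hx
    have hd : ‖(g' : X) - x‖ < 1 / 2 := by
      simpa [dist_eq_norm] using hgx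
    have h1 : ‖φ x ((g' : X) - x)‖ ≤ 1 / 2 :=
      ((φ x).le_of_opNorm_le (hφ1 x) _).trans (by linarith)
    have h2 : ‖φ x (x : X)‖ = 1 := by rw [hφ2, hx1]; simp
    have h3 : 1 / 2 ≤ ‖φ x (g' : X)‖ := by
      have := norm_sub_norm_le (φ x (x : X)) (φ x (x : X) - φ x (g' : X))
      rw [sub_sub_cancel, norm_sub_rev (φ x (x : X)), ← map_sub] at this
      linarith
    have h4 : ‖φ x (g' : X)‖ = ‖g‖⁻¹ * ‖φ x g‖ := by
      simp [hg']
    rw [h4] at h3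
    have hpos : 0 < ‖g‖ := norm_pos_iff.2 hg0
    rw [inv_mul_eq_div, le_div_iff₀ hpos] at h3
    linarith

/-- Each new term is chosen almost annihilated by functionals that norm the span of the earlier
ones. A weak cluster point lies in the closed span of the sequence and is killed by all these
norming functionals, hence is zero; weak compactness then gives convergence. -/
theorem IsReflexiveSpace.exists_seq_tendsto_zero (h : IsReflexiveSpace X) {A : Set X}
    (hA : Bornology.IsBounded A) (h0 : (0 : WeakSpace ℂ X) ∈ closure (toWeakSpace ℂ X '' A)) :
    ∃ a : ℕ → X, (∀ n, a n ∈ A) ∧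
      ∀ φ : StrongDual ℂ X, Tendsto (fun n => φ (a n)) atTop (𝓝 0) := by
  classical
  choose Φ hΦ1 hΦ2 using fun s : Finset X => exists_finset_norming s
  -- `Φ` need not be monotone; the union over all subsets retains the functionals chosen at earlier
  -- stages.
  set Ψ : Finset X → Finset (StrongDual ℂ X) := fun s => s.powerset.biUnion Φ with hΨ
  have pick : ∀ (s : Finset X) (n : ℕ), ∃ a ∈ A, ∀ φ ∈ Ψ s, ‖φ a‖ < 1 / ((n : ℝ) + 1) := by
    intro s n
    have hU : {z : WeakSpace ℂ X | ∀ φ ∈ Ψ s, ‖φ ((toWeakSpace ℂ X).symm z)‖ < 1 / ((n : ℝ) + 1)}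
        ∈ 𝓝 (0 : WeakSpace ℂ X) := by
      have : ∀ φ ∈ Ψ s, ∀ᶠ z in 𝓝 (0 : WeakSpace ℂ X),
          ‖φ ((toWeakSpace ℂ X).symm z)‖ < 1 / ((n : ℝ) + 1) := by
        intro φ _
        have hc := (continuous_weakSpace_eval φ).norm.tendsto 0
        refine hc.eventually_lt_const ?_
        simp
        positivity
      exact (Filter.eventually_all_finset (Ψ s)).2 this
    obtain ⟨_, hz, a, ha, rfl⟩ := mem_closure_iff_nhds.1 h0 _ hU
    exact ⟨a, ha, fun φ hφ => by simpa using hz φ hφ⟩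
  choose p hpA hp using pick
  obtain ⟨s, hs⟩ : ∃ s : ℕ → Finset X, ∀ n, s (n + 1) = insert (p (s n) n) (s n) :=
    ⟨fun n => Nat.rec ∅ (fun k t => insert (p t k) t) n, fun n => rfl⟩
  have hmono : Monotone s := monotone_nat_of_le_succ fun n => by
    rw [hs]; exact Finset.subset_insert _ _
  set a : ℕ → X := fun n => p (s n) n with ha
  have has : ∀ n, a n ∈ s (n + 1) := fun n => by rw [hs]; exact Finset.mem_insert_self _ _
  have hφ : ∀ m, ∀ φ ∈ Φ (s m), Tendsto (fun n => φ (a n)) atTop (𝓝 0) := by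
    intro m φ hφ
    refine squeeze_zero_norm' ?_ tendsto_one_div_add_atTop_nhds_zero_nat
    filter_upwards [eventually_ge_atTop m] with n hn
    exact (hp (s n) n φ (Finset.mem_biUnion.2
      ⟨s m, Finset.mem_powerset.2 (hmono hn), hφ⟩)).le
  refine ⟨a, fun n => hpA _ _, fun φ => ?_⟩
  suffices hw : Tendsto (fun n => toWeakSpace ℂ X (a n)) atTop (𝓝 0) by
    have := ((continuous_weakSpace_eval φ).tendsto 0).comp hw
    rwa [map_zero, map_zero] at this
  refine (h.isCompact_closure hA).tendsto_nhds_of_unique_mapClusterPt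
    (Eventually.of_forall fun n => subset_closure ⟨a n, hpA _ _, rfl⟩) fun y _ hy => ?_
  set y' : X := (toWeakSpace ℂ X).symm y with hy'
  have hcl : ∀ ψ : StrongDual ℂ X, Tendsto (fun n => ψ (a n)) atTop (𝓝 0) → ψ y' = 0 := by
    intro ψ hψ
    have h1 : MapClusterPt (ψ y') atTop (fun n => ψ (a n)) :=
      hy.continuousAt_comp (f := fun z : WeakSpace ℂ X => ψ ((toWeakSpace ℂ X).symm z))
        (continuous_weakSpace_eval ψ).continuousAt
    have : (𝓝 (ψ y') ⊓ 𝓝 0).NeBot := h1.clusterPt.mono hψ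
    exact eq_of_nhds_neBot this
  let V : Submodule ℂ X := Submodule.span ℂ (⋃ n : ℕ, (s n : Set X))
  have hyV : y' ∈ closure (V : Set X) := by
    by_contra hn
    obtain ⟨ψ, hψ, hne⟩ := V.exists_strongDual_of_notMem_closure hn
    refine hne (hcl ψ ?_)
    have : ∀ n, ψ (a n) = 0 := fun n =>
      hψ _ (Submodule.subset_span (Set.mem_iUnion.2 ⟨n + 1, has n⟩))
    simp [this]
  have hV : ∀ g ∈ V, ∃ m, g ∈ Submodule.span ℂ (s m : Set X) := by
    intro g hg
    have hdir : Directed (· ≤ ·) fun n => Submodule.span ℂ (s n : Set X) :=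
      Monotone.directed_le fun i j hij => Submodule.span_mono (by exact_mod_cast hmono hij)
    rw [show V = ⨆ n, Submodule.span ℂ (s n : Set X) from Submodule.span_iUnion _] at hg
    exact (Submodule.mem_iSup_of_directed _ hdir).1 hg
  have hy0 : y' = 0 := by
    rw [← norm_le_zero_iff]
    refine le_of_forall_pos_le_add fun ε hε => ?_
    obtain ⟨g, hg, hgy⟩ := Metric.mem_closure_iff.1 hyV (ε / 3) (by positivity)
    rw [dist_eq_norm] at hgy
    obtain ⟨m, hm⟩ := hV g hg
    -- For a norming `ψ` with `ψ y' = 0`, one has `‖g‖ ≤ 2‖ψ g‖ = 2‖ψ (y' - g)‖`.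
    have hgn : ‖g‖ ≤ 2 * (ε / 3) := by
      by_cases hg0 : g = 0
      · simp [hg0]; positivity
      · obtain ⟨ψ, hψ, hle⟩ := hΦ2 (s m) g hm hg0
        have h1 : ψ y' = 0 := hcl ψ (hφ m ψ hψ)
        have h2 : ‖ψ (y' - g)‖ ≤ 1 * ‖y' - g‖ := ψ.le_of_opNorm_le (hΦ1 _ ψ hψ) _
        rw [map_sub, h1, zero_sub, norm_neg] at h2
        linarith
    have := norm_le_norm_add_norm_sub' y' g
    linarith
  exact (toWeakSpace ℂ X).symm.map_eq_zero_iff.1 hy0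

/-- In a reflexive space, weak closure points of bounded sets are limits of weakly convergent
sequences. -/
theorem IsReflexiveSpace.exists_seq_tendsto (h : IsReflexiveSpace X) {A : Set X}
    (hA : Bornology.IsBounded A) {x : X}
    (hx : toWeakSpace ℂ X x ∈ closure (toWeakSpace ℂ X '' A)) :
    ∃ a : ℕ → X, (∀ n, a n ∈ A) ∧
      ∀ φ : StrongDual ℂ X, Tendsto (fun n => φ (a n)) atTop (𝓝 (φ x)) := by
  have hB : Bornology.IsBounded ((fun z => z - x) '' A) := by
    obtain ⟨C, hC⟩ := hA.exists_norm_le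
    refine isBounded_iff_forall_norm_le.2 ⟨C + ‖x‖, ?_⟩
    rintro _ ⟨z, hz, rfl⟩
    exact (norm_sub_le _ _).trans (by linarith [hC z hz])
  obtain ⟨b, hb, hlim⟩ := h.exists_seq_tendsto_zero hB (by
    have hc : Continuous fun z : WeakSpace ℂ X => z - toWeakSpace ℂ X x :=
      continuous_id.sub continuous_const
    have := image_closure_subset_closure_image hc ⟨_, hx, rfl⟩
    beta_reduce at this
    rw [sub_self, Set.image_image] at this
    rw [Set.image_image]
    simpa using this)
  choose a ha hab using hb
  refine ⟨a, ha, fun φ => ?_⟩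
  have := (hlim φ).add_const (φ x)
  simpa [← hab] using this

end BanachSpaces

/-! ### Homogeneous polynomials: growth, products, composition, derivatives -/

namespace HomPoly

variable {N : ℕ} {E F : Type*} [NormedAddCommGroup E] [NormedSpace ℂ E]
  [NormedAddCommGroup F] [NormedSpace ℂ F]

/-- The homogeneous polynomial of a continuous multilinear map. -/
def ofMultilinear (A : ContinuousMultilinearMap ℂ (fun _ : Fin N => E) F) : HomPoly N E F :=
  ⟨fun x => A fun _ => x, A, fun _ => rfl⟩

theorem ofMultilinear_apply (A : ContinuousMultilinearMap ℂ (fun _ : Fin N => E) F) (x : E) :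
    ofMultilinear A x = A fun _ => x := rfl

theorem exists_ofMultilinear (P : HomPoly N E F) : ∃ A, P = ofMultilinear A := by
  obtain ⟨A, hA⟩ := P.exists_multilinear
  exact ⟨A, DFunLike.ext _ _ hA⟩

theorem sub_apply (P Q : HomPoly N E F) (x : E) : (P - Q) x = P x - Q x := rfl

theorem norm_apply_le_pow (P : HomPoly N E F) (x : E) : ‖P x‖ ≤ ‖P‖ * ‖x‖ ^ N := by
  by_cases hx : x = 0
  · subst hx
    cases N with
    | zero => simpa using P.norm_apply_le (x := 0) (by simp)
    | succ n =>
      have : P 0 = 0 := by simpa using P.map_smul_pow 0 0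
      simp [this]
  · have hx' : ‖x‖ ≠ 0 := norm_ne_zero_iff.2 hx
    have h1 : x = (‖x‖ : ℂ) • ((‖x‖ : ℂ)⁻¹ • x) := by
      rw [smul_smul, mul_inv_cancel₀ (by exact_mod_cast hx'), one_smul]
    have h2 : ‖P ((‖x‖ : ℂ)⁻¹ • x)‖ ≤ ‖P‖ := P.norm_apply_le (by simp [norm_smul, hx'])
    calc ‖P x‖ = ‖x‖ ^ N * ‖P ((‖x‖ : ℂ)⁻¹ • x)‖ := by
          conv_lhs => rw [h1]
          rw [map_smul_pow, norm_smul]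
          simp
      _ ≤ ‖x‖ ^ N * ‖P‖ := by gcongr
      _ = _ := mul_comm _ _

theorem norm_le_of_forall {P : HomPoly N E F} {C : ℝ} (h : ∀ x, ‖x‖ ≤ 1 → ‖P x‖ ≤ C) :
    ‖P‖ ≤ C := by
  have : Nonempty (Metric.closedBall (0 : E) 1) := ⟨⟨0, by simp⟩⟩
  exact ciSup_le fun x => h x (mem_closedBall_zero_iff.1 x.2)

theorem differentiable (P : HomPoly N E F) : Differentiable ℂ P := by
  obtain ⟨A, rfl⟩ := P.exists_ofMultilinear
  have : Differentiable ℂ fun x : E => A fun _ => x :=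
    (A.contDiff (n := 1)).differentiable (by simp) |>.comp
      (differentiable_pi.2 fun _ => differentiable_id)
  exact this

protected theorem continuous (P : HomPoly N E F) : Continuous P := P.differentiable.continuous

/-- Evaluation at a point, as a continuous functional. -/
noncomputable def eval (N : ℕ) (x : E) : StrongDual ℂ (HomPoly N E ℂ) :=
  LinearMap.mkContinuous
    { toFun := fun P => P x
      map_add' := fun _ _ => rfl
      map_smul' := fun _ _ => rfl }
    (‖x‖ ^ N) fun P => by
      rw [mul_comm]
      exact P.norm_apply_le_pow x

@[simp] theorem eval_apply (x : E) (P : HomPoly N E ℂ) : eval N x P = P x := rfl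

/-- Precomposition with a continuous linear map. -/
theorem exists_comp_continuousLinearMap (P : HomPoly N E F) (T : E →L[ℂ] E) :
    ∃ R : HomPoly N E F, ∀ x, R x = P (T x) := by
  obtain ⟨A, rfl⟩ := P.exists_ofMultilinear
  exact ⟨ofMultilinear (A.compContinuousLinearMap fun _ => T), fun x => rfl⟩

theorem exists_pow_smul (M : ℕ) (φ : StrongDual ℂ E) (y : F) :
    ∃ R : HomPoly M E F, ∀ x, R x = φ x ^ M • y :=
  ⟨ofMultilinear (((ContinuousMultilinearMap.mkPiAlgebra ℂ (Fin M) ℂ).compContinuousLinearMap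
    fun _ => φ).smulRight y), fun x => by simp [ofMultilinear_apply]⟩

/-- Composing an `N`-homogeneous polynomial with an `M`-homogeneous one gives an
`N * M`-homogeneous one. -/
theorem exists_comp {G : Type*} [NormedAddCommGroup G] [NormedSpace ℂ G] {M : ℕ}
    (Q : HomPoly N F G) (P : HomPoly M E F) :
    ∃ R : HomPoly (N * M) E G, ∀ x, R x = Q (P x) := by
  obtain ⟨A, rfl⟩ := P.exists_ofMultilinear
  obtain ⟨B, rfl⟩ := Q.exists_ofMultilinear
  let e : (Σ _ : Fin N, Fin M) ≃ Fin (N * M) :=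
    (Equiv.sigmaEquivProd _ _).trans finProdFinEquiv
  let C : MultilinearMap ℂ (fun _ : Fin (N * M) => E) G :=
    (B.toMultilinearMap.compMultilinearMap fun _ => A.toMultilinearMap).domDomCongr e
  have hC : ∀ v, C v = B fun i => A fun j => v (e ⟨i, j⟩) := fun v => rfl
  refine ⟨ofMultilinear ⟨C, ?_⟩, fun x => rfl⟩
  change Continuous fun v => C v
  simp only [hC]
  exact B.cont.comp (continuous_pi fun i => A.cont.comp (continuous_pi fun j => continuous_apply _))

/-- The polynomials `φ₀ ^ m * φ`, as a continuous linear function of `φ`. -/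
theorem exists_powMul (m : ℕ) (φ₀ : StrongDual ℂ E) :
    ∃ j : StrongDual ℂ E →L[ℂ] HomPoly (m + 1) E ℂ, ∀ φ x, j φ x = φ₀ x ^ m * φ x := by
  let A : StrongDual ℂ E → ContinuousMultilinearMap ℂ (fun _ : Fin (m + 1) => E) ℂ := fun φ =>
    (ContinuousMultilinearMap.mkPiAlgebra ℂ (Fin (m + 1)) ℂ).compContinuousLinearMap
      (Fin.cons φ fun _ => φ₀)
  have hA : ∀ φ x, ofMultilinear (A φ) x = φ₀ x ^ m * φ x := fun φ x => by
    simp [ofMultilinear_apply, A, Fin.prod_univ_succ, mul_comm]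
  refine ⟨LinearMap.mkContinuous
    { toFun := fun φ => ofMultilinear (A φ)
      map_add' := fun φ ψ => DFunLike.ext _ _ fun x => by
        rw [add_apply, hA, hA, hA, _root_.add_apply, mul_add]
      map_smul' := fun c φ => DFunLike.ext _ _ fun x => by
        rw [RingHom.id_apply, smul_apply, hA, hA, _root_.smul_apply, smul_eq_mul,
          smul_eq_mul, mul_left_comm] } (‖φ₀‖ ^ m) fun φ => ?_, hA⟩
  refine norm_le_of_forall fun x hx => ?_
  change ‖ofMultilinear (A φ) x‖ ≤ _
  rw [hA, norm_mul, norm_pow]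
  gcongr
  · simpa using φ₀.le_of_opNorm_le_of_le le_rfl hx
  · simpa using φ.le_of_opNorm_le_of_le le_rfl hx

theorem fderiv_add_apply (P Q : HomPoly N E F) (e : E) :
    fderiv ℂ (P + Q : HomPoly N E F) e = fderiv ℂ P e + fderiv ℂ Q e :=
  ((P.differentiable e).hasFDerivAt.add (Q.differentiable e).hasFDerivAt).fderiv

theorem fderiv_smul_apply (c : ℂ) (P : HomPoly N E F) (e : E) :
    fderiv ℂ (c • P : HomPoly N E F) e = c • fderiv ℂ P e :=
  ((P.differentiable e).hasFDerivAt.const_smul c).fderiv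

/-- Cauchy's estimate for `t ↦ P (e + t • x)` on the unit circle, where the argument has norm at
most `‖e‖ + 1`. -/
theorem norm_fderiv_apply_le (P : HomPoly N E F) (e : E) {x : E} (hx : ‖x‖ = 1) :
    ‖fderiv ℂ P e x‖ ≤ (‖e‖ + 1) ^ N * ‖P‖ := by
  have hd : HasDerivAt (fun t : ℂ => P (e + t • x)) (fderiv ℂ P e x) 0 := by
    have h1 : HasDerivAt (fun t : ℂ => e + t • x) x 0 := by
      simpa using ((hasDerivAt_id (0 : ℂ)).smul_const x).const_add e
    have h2 : HasFDerivAt P (fderiv ℂ P e) (e + (0 : ℂ) • x) := by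
      simpa using (P.differentiable e).hasFDerivAt
    exact h2.comp_hasDerivAt (0 : ℂ) h1
  have hdiff : Differentiable ℂ fun t : ℂ => P (e + t • x) :=
    P.differentiable.comp ((differentiable_id.smul_const x).const_add e)
  rw [← hd.deriv]
  have := Complex.norm_deriv_le_of_forall_mem_sphere_norm_le (c := (0 : ℂ)) (R := 1)
    (C := (‖e‖ + 1) ^ N * ‖P‖) one_pos hdiff.diffContOnCl fun t ht => ?_
  · simpa using this
  · have ht1 : ‖t‖ = 1 := by simpa using ht
    refine (P.norm_apply_le_pow _).trans ?_
    rw [mul_comm]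
    gcongr
    refine (norm_add_le _ _).trans ?_
    rw [norm_smul, ht1, hx, one_mul]

/-- The derivative at a point, as a continuous linear function of the polynomial. -/
theorem exists_fderiv (e : E) :
    ∃ D : HomPoly N E ℂ →L[ℂ] StrongDual ℂ E, ∀ P, D P = fderiv ℂ P e := by
  let L : HomPoly N E ℂ →ₗ[ℂ] StrongDual ℂ E :=
    { toFun := fun P => fderiv ℂ P e
      map_add' := fun P Q => fderiv_add_apply P Q e
      map_smul' := fun c P => fderiv_smul_apply c P e }
  exact ⟨L.mkContinuous ((‖e‖ + 1) ^ N) fun P =>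
    ContinuousLinearMap.opNorm_le_of_unit_norm (𝕜 := ℂ) (f := fderiv ℂ P e)
      (mul_nonneg (by positivity) (norm_nonneg P)) fun x hx => P.norm_fderiv_apply_le e hx,
    fun P => rfl⟩

end HomPoly

/-! ### Reflexivity of the underlying space -/

/-- With `φ₀ e = 1`, the map `φ ↦ φ₀ ^ m * φ` embeds the dual as a complemented subspace of the
polynomials. The derivative at `e` returns `φ + m φ(e) φ₀`, and evaluation at `e` supplies the
`φ(e)` needed to cancel the second term. -/
theorem IsPolyReflexiveOfDegree.isReflexiveSpace {E : Type*} [NormedAddCommGroup E]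
    [NormedSpace ℂ E] [CompleteSpace E] {N : ℕ} (hN : 1 ≤ N) (h : IsPolyReflexiveOfDegree N E) :
    IsReflexiveSpace E := by
  obtain ⟨m, rfl⟩ : ∃ m, N = m + 1 := ⟨N - 1, by omega⟩
  cases subsingleton_or_nontrivial E with
  | inl hE =>
    intro ξ
    refine ⟨0, ContinuousLinearMap.ext fun φ => ?_⟩
    have : φ = 0 := ContinuousLinearMap.ext fun x => by simp [Subsingleton.elim x 0]
    simp [this]
  | inr hE =>
    obtain ⟨x, hx⟩ := exists_ne (0 : E)
    obtain ⟨φ₀, -, hφ₀⟩ := exists_dual_vector ℂ x (norm_ne_zero_iff.2 hx)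
    obtain ⟨e, he⟩ : ∃ e, φ₀ e = 1 := ⟨(‖x‖ : ℂ)⁻¹ • x, by
      rw [map_smul, hφ₀, smul_eq_mul]
      exact inv_mul_cancel₀ (by simpa using hx)⟩
    obtain ⟨j, hj⟩ := HomPoly.exists_powMul m φ₀
    obtain ⟨D, hD⟩ := HomPoly.exists_fderiv (N := m + 1) e
    refine IsReflexiveSpace.of_strongDual (IsReflexiveSpace.of_leftInverse h j
      (D - (m : ℂ) • (HomPoly.eval (m + 1) e).smulRight φ₀) fun φ => ?_)
    have hfun : (j φ : E → ℂ) = fun x => φ₀ x ^ m * φ x := funext (hj φ)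
    have hder : HasFDerivAt (j φ : E → ℂ) (φ + ((m : ℂ) * φ e) • φ₀) e := by
      rw [hfun]
      have := (φ₀.hasFDerivAt (x := e)).pow m |>.mul (φ.hasFDerivAt (x := e))
      refine this.congr_fderiv (ContinuousLinearMap.ext fun x => ?_)
      simp only [_root_.add_apply, _root_.smul_apply, he, one_pow, smul_eq_mul, nsmul_eq_mul]
      ring
    ext x
    simp only [_root_.sub_apply, _root_.smul_apply, hD, hder.fderiv,
      ContinuousLinearMap.smulRight_apply, HomPoly.eval_apply, hj, he, smul_eq_mul,
      _root_.add_apply]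
    ring

/-! ### Functionals on the polynomial space and compact sets -/

namespace HomPoly

variable {N : ℕ} {E : Type*} [NormedAddCommGroup E] [NormedSpace ℂ E]

/-- The functionals dominated by the supremum over a finite subset of the unit ball. -/
def finitelyDominated (N : ℕ) (E : Type*) [NormedAddCommGroup E] [NormedSpace ℂ E] :
    Set (StrongDual ℂ (HomPoly N E ℂ)) :=
  {f | ∃ s : Set E, s.Finite ∧ (∀ x ∈ s, ‖x‖ ≤ 1) ∧
    ∀ (R : HomPoly N E ℂ) (c : ℝ), 0 ≤ c → (∀ x ∈ s, ‖R x‖ ≤ c) → ‖f R‖ ≤ c}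

theorem convex_finitelyDominated : Convex ℝ (finitelyDominated N E) := by
  rintro f ⟨s, hs, hs1, hf⟩ g ⟨t, ht, ht1, hg⟩ a b ha hb hab
  refine ⟨s ∪ t, hs.union ht, fun x hx => hx.elim (hs1 x) (ht1 x), fun R c hc h => ?_⟩
  have h1 := hf R c hc fun x hx => h x (Or.inl hx)
  have h2 := hg R c hc fun x hx => h x (Or.inr hx)
  calc ‖(a • f + b • g) R‖ = ‖a • f R + b • g R‖ := rfl
    _ ≤ a * ‖f R‖ + b * ‖g R‖ := by
      refine (norm_add_le _ _).trans_eq ?_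
      rw [norm_smul, norm_smul, Real.norm_of_nonneg ha, Real.norm_of_nonneg hb]
    _ ≤ a * c + b * c := by gcongr
    _ = c := by rw [← add_mul, hab, one_mul]

/-- By reflexivity a separating functional would be evaluation at some `P`. The set contains all
point evaluations from the unit ball, rotated by any phase, so the separating constant is at least
`‖P‖`, which no functional of norm at most `1` exceeds at `P`. -/
theorem mem_closure_finitelyDominated (h : IsPolyReflexiveOfDegree N E)
    {f : StrongDual ℂ (HomPoly N E ℂ)} (hf : ‖f‖ ≤ 1) : f ∈ closure (finitelyDominated N E) := by
  by_contra hn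
  obtain ⟨Ψ, u, hu, hlt⟩ := RCLike.geometric_hahn_banach_closed_point (𝕜 := ℂ)
    convex_finitelyDominated.closure isClosed_closure hn
  obtain ⟨P, rfl⟩ := h Ψ
  have hP : ‖P‖ ≤ u := norm_le_of_forall fun x hx => by
    obtain ⟨ω, hω, hωx⟩ : ∃ ω : ℂ, ‖ω‖ ≤ 1 ∧ ω * P x = (‖P x‖ : ℂ) := by
      by_cases h0 : P x = 0
      · exact ⟨0, by simp, by simp [h0]⟩
      · have h1 : ‖P x‖ ≠ 0 := norm_ne_zero_iff.2 h0
        refine ⟨‖P x‖ / P x, ?_, div_mul_cancel₀ _ h0⟩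
        rw [norm_div, Complex.norm_real, norm_norm, div_self h1]
    have := hu (ω • eval N x) (subset_closure ⟨{x}, Set.finite_singleton x, by simpa using hx,
      fun R c hc hR => by
        rw [_root_.smul_apply, eval_apply, smul_eq_mul, norm_mul]
        have := hR x rfl
        nlinarith [norm_nonneg (R x), norm_nonneg ω]⟩)
    rw [NormedSpace.dual_def, _root_.smul_apply, eval_apply, smul_eq_mul, hωx] at this
    simpa using this.le
  rw [NormedSpace.dual_def] at hlt
  have h1 : ‖f P‖ ≤ 1 * ‖P‖ := f.le_of_opNorm_le hf P
  have h2 : RCLike.re (f P) ≤ ‖f P‖ := RCLike.re_le_norm _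
  linarith

theorem exists_finite_approx (h : IsPolyReflexiveOfDegree N E) {r ε : ℝ} (hr : 0 < r)
    (hε : 0 < ε) {f : StrongDual ℂ (HomPoly N E ℂ)} (hf : ‖f‖ ≤ r) :
    ∃ (f' : StrongDual ℂ (HomPoly N E ℂ)) (s : Set E), ‖f'‖ ≤ ε ∧ s.Finite ∧
      (∀ x ∈ s, ‖x‖ ≤ 1) ∧ ∀ (R : HomPoly N E ℂ) (c : ℝ), 0 ≤ c → (∀ x ∈ s, ‖R x‖ ≤ c) →
        ‖f R - f' R‖ ≤ r * c := by
  have hr' : (r : ℂ) ≠ 0 := by exact_mod_cast hr.ne'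
  have hf1 : ‖(r : ℂ)⁻¹ • f‖ ≤ 1 := by
    rw [norm_smul, norm_inv, Complex.norm_real, Real.norm_of_nonneg hr.le, inv_mul_le_iff₀ hr]
    linarith
  obtain ⟨g, ⟨s, hs, hs1, hg⟩, hd⟩ :=
    Metric.mem_closure_iff.1 (mem_closure_finitelyDominated h hf1) (ε / r) (by positivity)
  refine ⟨f - (r : ℂ) • g, s, ?_, hs, hs1, fun R c hc hR => ?_⟩
  · have : f - (r : ℂ) • g = (r : ℂ) • ((r : ℂ)⁻¹ • f - g) := by
      rw [smul_sub, smul_smul, mul_inv_cancel₀ hr', one_smul]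
    rw [this, norm_smul, Complex.norm_real, Real.norm_of_nonneg hr.le]
    rw [dist_eq_norm, lt_div_iff₀ hr] at hd
    linarith
  · have : f R - (f - (r : ℂ) • g) R = (r : ℂ) * g R := by
      rw [_root_.sub_apply, _root_.smul_apply, smul_eq_mul, sub_sub_cancel]
    rw [this, norm_mul, Complex.norm_real, Real.norm_of_nonneg hr.le]
    exact mul_le_mul_of_nonneg_left (hg R c hc hR) hr.le

/-- The union of a null sequence of finite sets with `{0}` is compact. -/
theorem _root_.isCompact_insert_zero_iUnion {X : Type*} [NormedAddCommGroup X] {s : ℕ → Set X}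
    (hs : ∀ k, (s k).Finite) {r : ℕ → ℝ} (hr : Tendsto r atTop (𝓝 0))
    (hsr : ∀ k, ∀ x ∈ s k, ‖x‖ ≤ r k) : IsCompact (insert 0 (⋃ k, s k)) := by
  classical
  refine isCompact_of_finite_subcover fun {ι} U hU hcov => ?_
  obtain ⟨i, hi⟩ := Set.mem_iUnion.1 (hcov (Set.mem_insert _ _))
  obtain ⟨δ, hδ, hball⟩ := Metric.isOpen_iff.1 (hU i) 0 hi
  obtain ⟨k₀, hk₀⟩ := eventually_atTop.1 (hr.eventually_lt_const hδ)
  have hfin : (⋃ k ∈ Finset.range k₀, s k).Finite :=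
    Set.Finite.biUnion (Finset.finite_toSet _) fun k _ => hs k
  obtain ⟨t, ht⟩ := hfin.isCompact.elim_finite_subcover U hU
    ((Set.iUnion₂_subset fun k _ => (Set.subset_iUnion s k).trans (Set.subset_insert _ _)).trans
      hcov)
  refine ⟨insert i t, ?_⟩
  rintro x (rfl | hx)
  · exact Set.mem_iUnion₂.2 ⟨i, Finset.mem_insert_self _ _, hi⟩
  · obtain ⟨k, hk⟩ := Set.mem_iUnion.1 hx
    by_cases hkk : k < k₀
    · obtain ⟨j, hj, hxj⟩ := Set.mem_iUnion₂.1
        (ht (Set.mem_iUnion₂.2 ⟨k, Finset.mem_range.2 hkk, hk⟩))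
      exact Set.mem_iUnion₂.2 ⟨j, Finset.mem_insert_of_mem hj, hxj⟩
    · refine Set.mem_iUnion₂.2 ⟨i, Finset.mem_insert_self _ _, hball ?_⟩
      rw [mem_ball_zero_iff]
      exact (hsr k x hk).trans_lt (hk₀ k (not_lt.1 hkk))

/-- If `𝒫(ᴺE)` is reflexive, its functionals are continuous for uniform convergence on compact
sets. -/
theorem exists_isCompact_dominating (h : IsPolyReflexiveOfDegree N E)
    (f : StrongDual ℂ (HomPoly N E ℂ)) :
    ∃ (K : Set E) (C : ℝ), IsCompact K ∧ 0 < C ∧ ∀ (R : HomPoly N E ℂ) (c : ℝ), 0 ≤ c →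
      (∀ x ∈ K, ‖R x‖ ≤ c) → ‖f R‖ ≤ C * c := by
  set r : ℝ := ‖f‖ + 1 with hr
  have hr0 : 0 < r := by positivity
  -- Shrinking the points of stage `k` by `2⁻ᵏ` costs a factor `2 ^ (N * k)` by homogeneity; the
  -- extra factor `1/2` leaves a summable `2⁻ᵏ`.
  set q : ℝ := (1 / 2) ^ (N + 1) with hq
  have hq0 : 0 < q := by positivity
  have hq1 : q < 1 := pow_lt_one₀ (by norm_num) (by norm_num) (by omega)
  -- The norm bound sits in the conclusion, so that `choose` gives a remainder for every functional
  -- and the recursion needs no proofs; when it fails, `0` and `∅` are placeholders.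
  have step : ∀ (k : ℕ) (g : StrongDual ℂ (HomPoly N E ℂ)),
      ∃ (g' : StrongDual ℂ (HomPoly N E ℂ)) (s : Set E), s.Finite ∧ (∀ x ∈ s, ‖x‖ ≤ 1) ∧
      (‖g‖ ≤ r * q ^ k → ‖g'‖ ≤ r * q ^ (k + 1) ∧
        ∀ (R : HomPoly N E ℂ) (c : ℝ), 0 ≤ c → (∀ x ∈ s, ‖R x‖ ≤ c) →
        ‖g R - g' R‖ ≤ r * q ^ k * c) := by
    intro k g
    by_cases hg : ‖g‖ ≤ r * q ^ k
    · obtain ⟨g', s, h1, h2, h3, h4⟩ := exists_finite_approx h (r := r * q ^ k)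
        (ε := r * q ^ (k + 1)) (by positivity) (by positivity) hg
      exact ⟨g', s, h2, h3, fun _ => ⟨h1, h4⟩⟩
    · exact ⟨0, ∅, Set.finite_empty, by simp, fun hg' => absurd hg' hg⟩
  choose next s hsfin hs1 hnext using step
  obtain ⟨g, hg0, hgs⟩ : ∃ g : ℕ → StrongDual ℂ (HomPoly N E ℂ),
      g 0 = f ∧ ∀ k, g (k + 1) = next k (g k) :=
    ⟨fun k => Nat.rec f (fun k u => next k u) k, rfl, fun _ => rfl⟩
  have hg : ∀ k, ‖g k‖ ≤ r * q ^ k := by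
    intro k
    induction k with
    | zero => rw [hg0]; simp [hr]
    | succ k ih => rw [hgs]; exact (hnext k _ ih).1
  let S : ℕ → Set E := fun k => (fun x : E => ((1 / 2 : ℂ) ^ k) • x) '' s k (g k)
  refine ⟨insert 0 (⋃ k, S k), 2 * r, isCompact_insert_zero_iUnion (fun k => (hsfin _ _).image _)
    (r := fun k => (1 / 2 : ℝ) ^ k) (tendsto_pow_atTop_nhds_zero_of_lt_one (by norm_num)
      (by norm_num)) ?_, by positivity, fun R c hc hR => ?_⟩
  · rintro k _ ⟨x, hx, rfl⟩
    have := hs1 k (g k) x hx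
    have h2 : ‖(1 / 2 : ℂ)‖ = 1 / 2 := by norm_num
    change ‖(1 / 2 : ℂ) ^ k • x‖ ≤ (1 / 2 : ℝ) ^ k
    rw [norm_smul, norm_pow, h2]
    exact mul_le_of_le_one_right (by positivity) this
  · have hstep : ∀ k, ‖g k R - g (k + 1) R‖ ≤ r * c * (1 / 2) ^ k := by
      intro k
      have h1 : ∀ x ∈ s k (g k), ‖R x‖ ≤ (2 : ℝ) ^ (N * k) * c := by
        intro x hx
        have h2 := hR (((1 / 2 : ℂ) ^ k) • x)
          (Or.inr (Set.mem_iUnion.2 ⟨k, x, hx, rfl⟩))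
        have h3 : ‖((1 / 2 : ℂ) ^ k) ^ N‖ = ((2 : ℝ) ^ (N * k))⁻¹ := by
          rw [← pow_mul, mul_comm k N, norm_pow, ← inv_pow]
          norm_num
        rw [map_smul_pow, norm_smul, h3, inv_mul_le_iff₀ (by positivity)] at h2
        exact h2
      have h4 := (hnext k _ (hg k)).2 R _ (by positivity) h1
      rw [← hgs] at h4
      refine h4.trans_eq ?_
      have : q ^ k * (2 : ℝ) ^ (N * k) = (1 / 2) ^ k := by
        rw [hq, ← pow_mul, add_mul, one_mul, pow_add, mul_right_comm, ← mul_pow]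
        norm_num
      rw [← this]
      ring
    -- Telescoping: `2 - 2 * (1 / 2) ^ m` is the sum of the first `m` powers of `1/2`.
    have hsum : ∀ m : ℕ, ‖f R‖ ≤ r * c * (2 - 2 * (1 / 2) ^ m) + ‖g m R‖ := by
      intro m
      induction m with
      | zero => simp [hg0]
      | succ m ih =>
        have h5 := norm_le_norm_add_norm_sub' (g m R) (g (m + 1) R)
        have h6 := hstep m
        rw [pow_succ]
        nlinarith
    have hlim : Tendsto (fun m : ℕ => 2 * r * c + r * q ^ m * ‖R‖) atTop
        (𝓝 (2 * r * c + r * 0 * ‖R‖)) :=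
      (((tendsto_pow_atTop_nhds_zero_of_lt_one hq0.le hq1).const_mul r).mul_const _).const_add _
    rw [mul_zero, zero_mul, add_zero] at hlim
    refine ge_of_tendsto' hlim fun m => ?_
    have h7 := (g m).le_of_opNorm_le (hg m) R
    have h8 : 0 ≤ r * c * (1 / 2) ^ m := by positivity
    linarith [hsum m]

/-! ### Weak sequential continuity of scalar polynomials -/

/-- The images stay in a norm-compact set, and functionals force every cluster point to be `T x`. -/
theorem _root_.ContinuousLinearMap.tendsto_of_isCompactOperator {F : Type*} [NormedAddCommGroup F] [NormedSpace ℂ F]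
    {T : E →L[ℂ] F} (hT : IsCompactOperator T) {u : ℕ → E} {x : E}
    (hb : Bornology.IsBounded (Set.range u))
    (hu : ∀ φ : StrongDual ℂ E, Tendsto (fun n => φ (u n)) atTop (𝓝 (φ x))) :
    Tendsto (fun n => T (u n)) atTop (𝓝 (T x)) := by
  have hK : IsCompact (closure (T '' Set.range u)) :=
    IsCompactOperator.isCompact_closure_image_of_bounded (f := T.toLinearMap) hT hb
  refine hK.tendsto_nhds_of_unique_mapClusterPt
    (Eventually.of_forall fun n => subset_closure ⟨u n, ⟨n, rfl⟩, rfl⟩) fun y _ hy => ?_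
  refine (SeparatingDual.eq_iff_forall_dual_eq (R := ℂ)).2 fun ψ => ?_
  have h1 : MapClusterPt (ψ y) atTop (fun n => ψ (T (u n))) :=
    hy.continuousAt_comp (f := ψ) ψ.continuous.continuousAt
  have : (𝓝 (ψ y) ⊓ 𝓝 (ψ (T x))).NeBot := h1.clusterPt.mono (hu (ψ.comp T))
  exact eq_of_nhds_neBot this

/-- If `𝒫(ᴺE)` is reflexive and `E` has the compact approximation property, then scalar
`N`-homogeneous polynomials are weakly sequentially continuous. -/
theorem tendsto_of_weak (h : IsPolyReflexiveOfDegree N E) (hE : HasCAP E) {u : ℕ → E} {x : E}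
    (hb : Bornology.IsBounded (Set.range u))
    (hu : ∀ φ : StrongDual ℂ E, Tendsto (fun n => φ (u n)) atTop (𝓝 (φ x)))
    (P : HomPoly N E ℂ) : Tendsto (fun n => P (u n)) atTop (𝓝 (P x)) := by
  let W : Submodule ℂ (HomPoly N E ℂ) :=
    { carrier := {R | Tendsto (fun n => R (u n)) atTop (𝓝 (R x))}
      add_mem' := fun h₁ h₂ => Tendsto.add h₁ h₂
      zero_mem' := tendsto_const_nhds
      smul_mem' := fun c _ hR => Tendsto.const_smul hR c }
  have hcl : P ∈ closure (W : Set (HomPoly N E ℂ)) := by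
    by_contra hn
    obtain ⟨f, hfW, hfP⟩ := W.exists_strongDual_of_notMem_closure hn
    refine hfP (norm_le_zero_iff.1 (le_of_forall_pos_le_add fun ε hε => ?_))
    obtain ⟨K, C, hK, hC, hdom⟩ := exists_isCompact_dominating h f
    have hc : 0 < ε / C := by positivity
    -- Only one of the two points has to lie in `K`; this matters because `T z` may leave it.
    have huc := hK.uniformContinuousAt_of_continuousAt P
      (fun a _ => P.continuous.continuousAt) (Metric.dist_mem_uniformity hc)
    obtain ⟨δ, hδ, hδP⟩ := Metric.mem_uniformity_dist.1 huc
    obtain ⟨T, hT, hTK⟩ := hE K hK (δ / 2) (by positivity)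
    obtain ⟨R, hR⟩ := P.exists_comp_continuousLinearMap T
    have hRW : R ∈ W := by
      change Tendsto (fun n => R (u n)) atTop (𝓝 (R x))
      simp only [hR]
      exact (P.continuous.tendsto _).comp (ContinuousLinearMap.tendsto_of_isCompactOperator hT hb hu)
    have h1 : ‖f (P - R)‖ ≤ C * (ε / C) := hdom _ _ hc.le fun z hz => by
      rw [sub_apply, hR, ← dist_eq_norm]
      refine (hδP ?_ hz).le
      rw [dist_comm, dist_eq_norm]
      linarith [hTK z hz]
    rw [map_sub, hfW R hRW, sub_zero, mul_div_cancel₀ _ hC.ne'] at h1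
    linarith
  obtain ⟨ρ, hρ⟩ := hb.exists_norm_le
  set B : ℝ := max ρ ‖x‖ with hB
  have hB0 : 0 ≤ B := (norm_nonneg x).trans (le_max_right _ _)
  rw [Metric.tendsto_atTop]
  intro ε hε
  -- On the ball of radius `B` this puts `P` and `R` within `ε / 3`; the `+ 1` gives a strict
  -- inequality even when `B ^ N = 0`.
  obtain ⟨R, hR, hPR⟩ := Metric.mem_closure_iff.1 hcl (ε / (3 * (B ^ N + 1))) (by positivity)
  rw [dist_eq_norm, lt_div_iff₀ (by positivity)] at hPR
  have hclose : ∀ z : E, ‖z‖ ≤ B → dist (P z) (R z) < ε / 3 := fun z hz => by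
    have h1 := (P - R).norm_apply_le_pow z
    have h2 : ‖P - R‖ * ‖z‖ ^ N ≤ ‖P - R‖ * B ^ N := by gcongr
    have h3 : 0 ≤ ‖P - R‖ := norm_nonneg _
    rw [dist_eq_norm, ← sub_apply]
    linarith
  obtain ⟨n₀, hn₀⟩ := Metric.tendsto_atTop.1 (show Tendsto (fun n => R (u n)) atTop (𝓝 (R x))
    from hR) (ε / 3) (by positivity)
  refine ⟨n₀, fun n hn => ?_⟩
  have h1 := hclose (u n) ((hρ _ ⟨n, rfl⟩).trans (le_max_left _ _))
  have h2 := hclose x (le_max_right _ _)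
  have h3 := hn₀ n hn
  have h4 := dist_triangle4 (P (u n)) (R (u n)) (R x) (P x)
  rw [dist_comm (R x)] at h4
  linarith

end HomPoly

/-! ### From weakly convergent sequences to weak continuity on bounded sets -/

section Main

variable {E F : Type*} [NormedAddCommGroup E] [NormedSpace ℂ E] [NormedAddCommGroup F]
  [NormedSpace ℂ F]

/-- Subtracting a suitable multiple of a power of a functional, a polynomial can be made to vanish
at a given point, without affecting convergence along weakly convergent sequences. -/
theorem HomPoly.exists_sub_tendsto {M : ℕ} (hM : 1 ≤ M) (P : HomPoly M E F) (x : E) :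
    ∃ H : HomPoly M E F, H x = 0 ∧ ∀ u : ℕ → E,
      (∀ φ : StrongDual ℂ E, Tendsto (fun n => φ (u n)) atTop (𝓝 (φ x))) →
      Tendsto (fun n => H (u n)) atTop (𝓝 0) → Tendsto (fun n => P (u n)) atTop (𝓝 (P x)) := by
  obtain ⟨φ, hφ⟩ : ∃ φ : StrongDual ℂ E, φ x ^ M • P x = P x := by
    by_cases hx : x = 0
    · refine ⟨0, ?_⟩
      have : P 0 = 0 := by
        simpa [zero_pow (Nat.one_le_iff_ne_zero.1 hM)] using P.map_smul_pow 0 0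
      simp [hx, this]
    · obtain ⟨φ, hφ⟩ := SeparatingDual.exists_eq_one (R := ℂ) hx
      exact ⟨φ, by simp [hφ]⟩
  obtain ⟨L, hL⟩ := HomPoly.exists_pow_smul M φ (P x)
  refine ⟨P - L, by rw [HomPoly.sub_apply, hL, hφ, sub_self], fun u hu h => ?_⟩
  have h1 : Tendsto (fun n => L (u n)) atTop (𝓝 (P x)) := by
    simp only [hL]
    have := ((hu φ).pow M).smul_const (P x)
    rwa [hφ] at this
  have h2 := h.add h1
  rw [zero_add] at h2
  exact h2.congr fun n => by rw [HomPoly.sub_apply, sub_add_cancel]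

/-- On reflexive spaces, weak-to-norm continuity on bounded sets can be tested on sequences. -/
theorem IsReflexiveSpace.weaklyContinuousOnBounded_eq_top {M : ℕ} (hE : IsReflexiveSpace E)
    (h : ∀ (P : HomPoly M E F) (u : ℕ → E) (x : E), Bornology.IsBounded (Set.range u) →
      (∀ φ : StrongDual ℂ E, Tendsto (fun n => φ (u n)) atTop (𝓝 (φ x))) →
      Tendsto (fun n => P (u n)) atTop (𝓝 (P x))) :
    HomPoly.weaklyContinuousOnBounded M E F = ⊤ := by
  refine eq_top_iff.2 fun P _ S hS => ?_
  rintro _ ⟨x, hx, rfl⟩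
  rw [ContinuousWithinAt, LinearEquiv.symm_apply_apply, Metric.tendsto_nhds]
  intro ε hε
  by_contra hn
  -- Failure of continuity makes `x` a weak closure point of the points of `S` where `P` stays `ε`
  -- away from `P x`; a sequence of such points contradicts `h`.
  have hfreq : toWeakSpace ℂ E x ∈
      closure (toWeakSpace ℂ E '' {z ∈ S | ε ≤ dist (P z) (P x)}) := by
    rw [mem_closure_iff_frequently]
    refine ((not_eventually.1 hn).and_eventually self_mem_nhdsWithin).filter_mono
      nhdsWithin_le_nhds |>.mono ?_
    rintro _ ⟨hz, z, hzS, rfl⟩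
    exact ⟨z, ⟨hzS, by simpa using hz⟩, rfl⟩
  obtain ⟨a, ha, hlim⟩ := hE.exists_seq_tendsto (hS.subset fun z hz => hz.1) hfreq
  have hb : Bornology.IsBounded (Set.range a) :=
    hS.subset (Set.range_subset_iff.2 fun n => (ha n).1)
  obtain ⟨n, hn⟩ := ((Metric.tendsto_nhds.1 (h P a x hb hlim)) ε hε).exists
  exact absurd hn (not_lt.2 (ha n).2)

theorem HomPoly.tendsto_comp_zero {N M : ℕ} (hN : 1 ≤ N)
    (h : IsPolyReflexiveOfDegree (N * M) E) (hE : HasCAP E) {H : HomPoly M E F} {u : ℕ → E} {x : E}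
    (hHx : H x = 0) (hb : Bornology.IsBounded (Set.range u))
    (hu : ∀ φ : StrongDual ℂ E, Tendsto (fun n => φ (u n)) atTop (𝓝 (φ x))) (Q : HomPoly N F ℂ) :
    Tendsto (fun n => Q (H (u n))) atTop (𝓝 0) := by
  obtain ⟨R, hR⟩ := Q.exists_comp H
  have hQ0 : Q 0 = 0 := by
    simpa [zero_pow (Nat.one_le_iff_ne_zero.1 hN)] using Q.map_smul_pow 0 0
  have := HomPoly.tendsto_of_weak h hE hb hu R
  simpa only [hR, hHx, hQ0] using this

end Main

theorem proposition5p2 {E : Type*} [NormedAddCommGroup E] [NormedSpace ℂ E] [CompleteSpace E]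
    {F : Type*} [NormedAddCommGroup F] [NormedSpace ℂ F] [CompleteSpace F] :
    (IsPolynomiallyReflexive E → HasCAP E → IsPolynomiallySchur F →
      ∀ N : ℕ, 1 ≤ N → HomPoly.weaklyContinuousOnBounded N E F = ⊤) ∧
    (∀ N M : ℕ, 1 ≤ N → 1 ≤ M →
      IsPolyReflexiveOfDegree (N * M) E → HasCAP E → IsPolySchurOfDegree N F →
        HomPoly.weaklyContinuousOnBounded M E F = ⊤) := by
  refine ⟨fun hrefl hcap hS N hN => ?_, fun N M hN hM hrefl hcap hS => ?_⟩
  · refine ((hrefl N hN).isReflexiveSpace hN).weaklyContinuousOnBounded_eq_top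
      fun P u x hb hu => ?_
    obtain ⟨H, hHx, hH⟩ := P.exists_sub_tendsto hN x
    -- A test polynomial of degree `k` composed with `H` has degree `k * N`, so reflexivity in every
    -- degree is used.
    exact hH u hu (hS _ fun k hk Q => HomPoly.tendsto_comp_zero hk
      (hrefl _ (Nat.mul_pos hk hN)) hcap hHx hb hu Q)
  · refine (hrefl.isReflexiveSpace (Nat.mul_pos hN hM)).weaklyContinuousOnBounded_eq_top
      fun P u x hb hu => ?_
    obtain ⟨H, hHx, hH⟩ := P.exists_sub_tendsto hM x
    exact hH u hu (hS _ fun Q => HomPoly.tendsto_comp_zero hN hrefl hcap hHx hb hu Q)
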